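/- Let $(X,d)$ be a compact metric space and let $T:X\to X$ be a homeomorphism that is uniquely ergodic, i.e. $T$ has exactly one invariant Borel probability measure $\mu$. Let $(q_n)$ be a strictly increasing sequence of positive integers with $\gcd(q_n,q_{n+1})=1$ for all $n$, and suppose that $$\max_{0\le t<q_{n+1}^{4/5}}\ \sup_{x\in X} d\bigl(x,T^{tq_n}x\bigr)\longrightarrow 0\qquad (n\to\infty),$$ where $t$ ranges over integers. Then for every (real- or complex-valued) continuous function $f$ on $X$, $$\lim_{N\to\infty}\frac1N\sum_{0\le i<N} f\bigl(T^{i^2}x\bigr)=\int_X f\,d\mu$$ uniformly in $x\in X$. -/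

import Mathlib

open MeasureTheory Filter Topology

/-- A homeomorphism `T` of a space with its Borel `σ`-algebra is uniquely ergodic if it has exactly
one invariant Borel probability measure. -/
def IsUniquelyErgodic {X : Type*} [TopologicalSpace X] [MeasurableSpace X] (T : X ≃ₜ X) : Prop :=
  ∃! μ : Measure X, IsProbabilityMeasure μ ∧ MeasurePreserving T μ μ

/-- `max_{t < b} sup_{x ∈ X} d(x, T^{t q} x)`, with `t` ranging over the natural numbers below the
real number `b`. On a compact metric space the quantities are bounded, and there are finitely many
`t`, so that the outer supremum is a maximum. -/
noncomputable def rigidityDefect {X : Type*} [MetricSpace X] (T : X ≃ₜ X) (q : ℕ) (b : ℝ) : ℝ :=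
  ⨆ t : {t : ℕ // (t : ℝ) < b}, ⨆ x : X, dist x ((⇑T)^[t * q] x)

/-! Write `q = q n`, `Q = q (n + 1)`, and let `L` be about `Q^(4/5)`. Rigidity at the indices `n`
and `n + 1` makes `s ↦ f (T^s y)` almost invariant under adding `t q` or `t Q` for `t < L`. On a
block starting at `b`, `(b + a)^2 = b^2 + (a^2 + 2ba)`; absorb `b^2` into the base point `y`. As
long as `a^2 + 2ba` stays below `Q L`, it may be reduced modulo `Q` and averaged over the shifts `t
q` at small cost.

The residues `a^2 + 2ba + tq` are equidistributed modulo `Q` in the `L²` sense. By Parseval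
(`abs_sum_sub_average_le`) only the exponential sums at `k ≠ 0` matter, and each factors into a
quadratic sum in `a` and a geometric sum in `t` with frequency `k q`. Coprimality makes `k ↦ k q` a
permutation. If `k q` is far from `0` modulo `Q`, the geometric sum is small. If it is close to `0`,
then `2k/Q` has a large reduced denominator and Weyl differencing bounds the quadratic sum
(`norm_quadratic_sum_sq_le_of_natAbs_le`). So a block average is close to the average of `f (T^r y)`
over `r < Q`, which unique ergodicity brings close to the integral uniformly in `y`.

With `R` about `Q^(1/40)`, this covers lengths from `R^31` to `R^41`, a range containing `Q`. From
there up to the 31st power of the next `R`, use blocks of length `Q`: `(jQ + a)^2 = (jQ)^2 + a^2 +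
(2ja) Q`, and rigidity at `Q` removes the last term, leaving the already treated length `Q`. The two
kinds of range together cover all large `N`. -/

/-! ### Uniform Birkhoff averages from unique ergodicity -/

/-- The empirical measure of the orbit segment `x, T x, …, T^N x`. -/
noncomputable def empiricalMeasure {X : Type*} [MeasurableSpace X] (T : X → X) (N : ℕ) (x : X) :
    Measure X :=
  -- Using `N + 1` points gives a probability measure for every `N`, including `N = 0`.
  ((N + 1 : ℕ) : ENNReal)⁻¹ • ∑ i ∈ Finset.range (N + 1), Measure.dirac (T^[i] x)

instance {X : Type*} [MeasurableSpace X] (T : X → X) (N : ℕ) (x : X) :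
    IsProbabilityMeasure (empiricalMeasure T N x) := by
  constructor
  simp only [empiricalMeasure, Measure.smul_apply, Measure.finsetSum_apply, measure_univ,
    Finset.sum_const, Finset.card_range, smul_eq_mul, nsmul_eq_mul, mul_one]
  exact ENNReal.inv_mul_cancel (by simp) (ENNReal.natCast_ne_top _)

theorem integral_empiricalMeasure {X : Type*} [TopologicalSpace X] [CompactSpace X]
    [MeasurableSpace X] [BorelSpace X] (T : X → X) (N : ℕ) (x : X) (g : C(X, ℝ)) :
    ∫ y, g y ∂(empiricalMeasure T N x) =
      ((N : ℝ) + 1)⁻¹ * ∑ i ∈ Finset.range (N + 1), g (T^[i] x) := by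
  have hg : StronglyMeasurable g := g.continuous.measurable.stronglyMeasurable
  rw [empiricalMeasure, integral_smul_measure, integral_finsetSum_measure]
  · simp only [integral_dirac' _ _ hg, smul_eq_mul]
    rw [ENNReal.toReal_inv, ENNReal.toReal_natCast]
    push_cast
    rfl
  · intro i _
    exact g.continuous.integrable_of_hasCompactSupport (HasCompactSupport.of_compactSpace _)

/-- For a uniquely ergodic homeomorphism, Birkhoff averages of continuous functions converge
uniformly to the integral. -/
theorem IsUniquelyErgodic.eventually_birkhoff {X : Type*} [MetricSpace X] [CompactSpace X]
    [MeasurableSpace X] [BorelSpace X] {T : X ≃ₜ X} (hT : IsUniquelyErgodic T)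
    {μ : Measure X} [IsProbabilityMeasure μ] (hμ : MeasurePreserving T μ μ) (f : C(X, ℝ))
    {ε : ℝ} (hε : 0 < ε) :
    ∀ᶠ N : ℕ in atTop, ∀ x,
      |((N : ℝ) + 1)⁻¹ * ∑ i ∈ Finset.range (N + 1), f (T^[i] x) - ∫ y, f y ∂μ| ≤ ε := by
  by_contra hcon
  -- The claim is vacuous on an empty space; otherwise `x₀` serves as a default base point at the
  -- times outside `S`.
  obtain ⟨x₀, -⟩ : ∃ x₀ : X, True := by
    by_contra h
    push Not at h
    exact hcon (Eventually.of_forall fun N x => (h x).elim)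
  have hfreq : ∃ᶠ N : ℕ in atTop, ∃ x,
      ε < |((N : ℝ) + 1)⁻¹ * ∑ i ∈ Finset.range (N + 1), f (T^[i] x) - ∫ y, f y ∂μ| := by
    simpa [Filter.Frequently] using hcon
  set S : Set ℕ := {N | ∃ x,
      ε < |((N : ℝ) + 1)⁻¹ * ∑ i ∈ Finset.range (N + 1), f (T^[i] x) - ∫ y, f y ∂μ|} with hS
  have hch : ∀ N : ℕ, ∃ x, N ∈ S →
      ε < |((N : ℝ) + 1)⁻¹ * ∑ i ∈ Finset.range (N + 1), f (T^[i] x) - ∫ y, f y ∂μ| := by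
    intro N
    by_cases h : N ∈ S
    · obtain ⟨x, hx⟩ := h
      exact ⟨x, fun _ => hx⟩
    · exact ⟨x₀, fun h' => (h h').elim⟩
  choose x hx using hch
  have hne : (atTop ⊓ 𝓟 S : Filter ℕ).NeBot := frequently_mem_iff_neBot.mp hfreq
  -- An ultrafilter tending to infinity inside the set of bad times replaces a convergent
  -- subsequence: compactness yields a limit of the empirical measures along it.
  let U : Ultrafilter ℕ := Ultrafilter.of (atTop ⊓ 𝓟 S)
  have hU : (U : Filter ℕ) ≤ atTop ⊓ 𝓟 S := Ultrafilter.of_le _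
  have hUtop : (U : Filter ℕ) ≤ atTop := hU.trans inf_le_left
  have hUS : S ∈ (U : Filter ℕ) := (hU.trans inf_le_right) (mem_principal_self S)
  let P : ℕ → ProbabilityMeasure X := fun N => ⟨empiricalMeasure T N (x N), inferInstance⟩
  obtain ⟨ν, -, hν⟩ := isCompact_univ.ultrafilter_le_nhds (U.map P) (by simp)
  have hlim : Tendsto P U (𝓝 ν) := hν
  have hint : ∀ g : C(X, ℝ), Tendsto (fun N : ℕ =>
      ((N : ℝ) + 1)⁻¹ * ∑ i ∈ Finset.range (N + 1), g (T^[i] (x N))) U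
      (𝓝 (∫ y, g y ∂(ν : Measure X))) := by
    intro g
    have h := (ProbabilityMeasure.tendsto_iff_forall_integral_tendsto.mp hlim)
      (BoundedContinuousFunction.mkOfCompact g)
    refine h.congr fun N => ?_
    exact integral_empiricalMeasure T N (x N) g
  have hinv : ∀ g : C(X, ℝ), ∫ y, g (T y) ∂(ν : Measure X) = ∫ y, g y ∂(ν : Measure X) := by
    intro g
    have h1 := hint (g.comp ⟨T, T.continuous⟩)
    have h2 := hint g
    have h3 : Tendsto (fun N : ℕ => 2 * ‖g‖ * (1 / ((N : ℝ) + 1))) U (𝓝 0) := by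
      have := (tendsto_one_div_add_atTop_nhds_zero_nat (𝕜 := ℝ)).const_mul (2 * ‖g‖)
      rw [mul_zero] at this
      exact this.mono_left hUtop
    -- Invariance of the limit: the averages of `g ∘ T` and `g` differ by a telescoping sum, of
    -- which only two boundary terms survive.
    have h4 := squeeze_zero_norm (f := fun N : ℕ =>
        ((N : ℝ) + 1)⁻¹ * ∑ i ∈ Finset.range (N + 1),
          (g.comp (⟨T, T.continuous⟩ : C(X, X))) (T^[i] (x N)) -
        ((N : ℝ) + 1)⁻¹ * ∑ i ∈ Finset.range (N + 1), g (T^[i] (x N))) (fun N => by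
      rw [← mul_sub, ← Finset.sum_sub_distrib]
      have : ∀ i, (g.comp (⟨T, T.continuous⟩ : C(X, X))) (T^[i] (x N)) - g (T^[i] (x N)) =
          g (T^[i + 1] (x N)) - g (T^[i] (x N)) := by
        intro i
        rw [Function.iterate_succ_apply']
        rfl
      simp only [this]
      rw [Finset.sum_range_sub (fun i => g (T^[i] (x N))), norm_mul, norm_inv]
      have hb : ‖g (T^[N + 1] (x N)) - g (T^[0] (x N))‖ ≤ 2 * ‖g‖ := by
        refine (norm_sub_le _ _).trans ?_
        linarith [g.norm_coe_le_norm (T^[N + 1] (x N)), g.norm_coe_le_norm (T^[0] (x N))]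
      have hn : ‖(N : ℝ) + 1‖ = N + 1 := Real.norm_of_nonneg (by positivity)
      rw [hn, mul_comm, ← one_div]
      gcongr) h3
    have h5 := tendsto_nhds_unique (h1.sub h2) h4
    exact sub_eq_zero.mp h5
  have hTν : MeasurePreserving T (ν : Measure X) (ν : Measure X) := by
    refine ⟨T.continuous.measurable, ?_⟩
    have : IsProbabilityMeasure (Measure.map T (ν : Measure X)) :=
      Measure.isProbabilityMeasure_map T.continuous.aemeasurable
    refine ext_of_forall_integral_eq_of_IsFiniteMeasure fun g => ?_
    rw [integral_map T.continuous.aemeasurable g.continuous.aestronglyMeasurable]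
    exact hinv g.toContinuousMap
  have hνμ : (ν : Measure X) = μ := hT.unique ⟨inferInstance, hTν⟩ ⟨inferInstance, hμ⟩
  have hf := hint f
  rw [hνμ] at hf
  have h0 : Tendsto (fun N : ℕ =>
      |((N : ℝ) + 1)⁻¹ * ∑ i ∈ Finset.range (N + 1), f (T^[i] (x N)) - ∫ y, f y ∂μ|) U (𝓝 0) := by
    simpa using (hf.sub_const (∫ y, f y ∂μ)).abs
  obtain ⟨N, hN, hNS⟩ := ((h0.eventually_lt_const hε).and hUS).exists
  exact absurd (hx N hNS) (not_lt.mpr hN.le)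

/-! ### Parseval and linear exponential sums modulo `Q` -/

section ExponentialSums

open ZMod

variable {Q : ℕ} [NeZero Q]

theorem norm_stdAddChar (x : ZMod Q) : ‖stdAddChar x‖ = 1 := by
  rw [stdAddChar_apply]; exact Circle.norm_coe _

theorem conj_stdAddChar (x : ZMod Q) :
    (starRingEnd ℂ) (stdAddChar x) = stdAddChar (-x) := by
  rw [AddChar.map_neg_eq_inv, ← Complex.inv_eq_conj (norm_stdAddChar x)]

/-- Parseval's identity on `ZMod Q`. -/
theorem sum_norm_sq_sum_mul_stdAddChar (c : ZMod Q → ℂ) :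
    ∑ k, ‖∑ r, c r * stdAddChar (k * r)‖ ^ 2 = Q * ∑ r, ‖c r‖ ^ 2 := by
  have h : ∑ k : ZMod Q, (∑ r, c r * stdAddChar (k * r)) *
      (starRingEnd ℂ) (∑ r, c r * stdAddChar (k * r)) =
      Q * ∑ r, c r * (starRingEnd ℂ) (c r) := by
    calc _ = ∑ k : ZMod Q, ∑ r, ∑ s, c r * (starRingEnd ℂ) (c s) * stdAddChar (k * (r - s)) := by
          refine Finset.sum_congr rfl fun k _ => ?_
          rw [map_sum, Finset.sum_mul_sum]
          refine Finset.sum_congr rfl fun r _ => Finset.sum_congr rfl fun s _ => ?_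
          rw [map_mul (starRingEnd ℂ), conj_stdAddChar, mul_sub, sub_eq_add_neg, AddChar.map_add_eq_mul]
          ring
      _ = ∑ r, ∑ s, c r * (starRingEnd ℂ) (c s) * ∑ k : ZMod Q, stdAddChar (k * (r - s)) := by
          rw [Finset.sum_comm]
          refine Finset.sum_congr rfl fun r _ => ?_
          rw [Finset.sum_comm]
          simp only [Finset.mul_sum]
      _ = _ := by
          rw [Finset.mul_sum]
          refine Finset.sum_congr rfl fun r _ => ?_
          simp only [AddChar.sum_mulShift _ (isPrimitive_stdAddChar Q), sub_eq_zero, ZMod.card]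
          rw [Finset.sum_eq_single r]
          · simp only [if_true]; ring
          · intro s _ hs; simp [hs.symm]
          · simp
  have h2 : ∀ z : ℂ, z * (starRingEnd ℂ) z = ((‖z‖ ^ 2 : ℝ) : ℂ) := by
    intro z; rw [Complex.mul_conj, Complex.normSq_eq_norm_sq]
  simp only [h2] at h
  exact_mod_cast h

/-- An `L²` equidistribution estimate: the sum of a bounded function over a finite family of
residues differs from its expected value by at most the `ℓ²`-norm of the nontrivial exponential
sums over the family. -/
theorem abs_sum_sub_average_le {ι : Type*} (s : Finset ι) (x : ι → ZMod Q) (G : ZMod Q → ℝ)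
    {M : ℝ} (hM : ∀ r, |G r| ≤ M) :
    |∑ i ∈ s, G (x i) - (s.card : ℝ) / Q * ∑ r, G r| ≤
      M * √(∑ k ∈ Finset.univ.erase 0, ‖∑ i ∈ s, stdAddChar (k * x i)‖ ^ 2) := by
  classical
  have hQ : (Q : ℝ) ≠ 0 := Nat.cast_ne_zero.mpr (NeZero.ne Q)
  have hM0 : 0 ≤ M := (abs_nonneg _).trans (hM 0)
  -- The excess of each fibre over its expected size. Its Fourier coefficient vanishes at `0` (`h3`)
  -- and elsewhere is the exponential sum of the family (`h2`).
  set c : ZMod Q → ℝ := fun r => ((s.filter fun i => x i = r).card : ℝ) - (s.card : ℝ) / Q with hc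
  have hcount : ∀ F : ZMod Q → ℂ, ∑ r, ((s.filter fun i => x i = r).card : ℂ) * F r =
      ∑ i ∈ s, F (x i) := by
    intro F
    rw [← Finset.sum_fiberwise_of_maps_to (s := s) (t := Finset.univ) (g := x) (by simp)]
    refine Finset.sum_congr rfl fun r _ => ?_
    rw [Finset.sum_congr rfl (g := fun _ => F r), Finset.sum_const, nsmul_eq_mul]
    intro i hi
    rw [(Finset.mem_filter.mp hi).2]
  have h1 : ∑ i ∈ s, G (x i) - (s.card : ℝ) / Q * ∑ r, G r = ∑ r, c r * G r := by
    have := hcount (fun r => (G r : ℂ))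
    have h' : ∑ r, ((s.filter fun i => x i = r).card : ℝ) * G r = ∑ i ∈ s, G (x i) := by
      exact_mod_cast this
    rw [← h', Finset.mul_sum, ← Finset.sum_sub_distrib]
    refine Finset.sum_congr rfl fun r _ => ?_
    simp only [hc]; ring
  have h2 : ∀ k ∈ Finset.univ.erase (0 : ZMod Q),
      ∑ r, (c r : ℂ) * stdAddChar (k * r) = ∑ i ∈ s, stdAddChar (k * x i) := by
    intro k hk
    have hk0 : k ≠ 0 := Finset.ne_of_mem_erase hk
    rw [← hcount (fun r => stdAddChar (k * r))]
    simp only [hc, Complex.ofReal_sub, sub_mul, Finset.sum_sub_distrib, Complex.ofReal_natCast]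
    rw [← Finset.mul_sum]
    have := AddChar.sum_mulShift k (isPrimitive_stdAddChar Q)
    simp only [mul_comm _ k, hk0, if_false] at this
    rw [this]; simp
  have h3 : ∑ r, (c r : ℂ) * stdAddChar ((0 : ZMod Q) * r) = 0 := by
    have := hcount (fun _ => 1)
    simp only [hc, zero_mul, AddChar.map_zero_eq_one, mul_one, Complex.ofReal_sub,
      Finset.sum_sub_distrib, Complex.ofReal_natCast] at this ⊢
    rw [this]
    simp only [Finset.sum_const, Finset.card_univ, ZMod.card, nsmul_eq_mul, mul_one,
      Complex.ofReal_div, Complex.ofReal_natCast]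
    have hQ' : (Q : ℂ) ≠ 0 := Nat.cast_ne_zero.mpr (NeZero.ne Q)
    field_simp; simp
  have h4 : ∑ k ∈ Finset.univ.erase 0, ‖∑ i ∈ s, stdAddChar (k * x i)‖ ^ 2 =
      Q * ∑ r, c r ^ 2 := by
    have hp := sum_norm_sq_sum_mul_stdAddChar (fun r => (c r : ℂ))
    rw [← Finset.add_sum_erase _ _ (Finset.mem_univ (0 : ZMod Q)), h3] at hp
    simp only [norm_zero, ne_eq, OfNat.ofNat_ne_zero, not_false_eq_true, zero_pow, zero_add,
      Complex.norm_real, Real.norm_eq_abs, sq_abs] at hp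
    rw [← hp]
    exact Finset.sum_congr rfl fun k hk => by rw [h2 k hk]
  rw [h1, h4]
  calc |∑ r, c r * G r| ≤ ∑ r, |c r| * M := by
        refine (Finset.abs_sum_le_sum_abs _ _).trans (Finset.sum_le_sum fun r _ => ?_)
        rw [abs_mul]
        exact mul_le_mul_of_nonneg_left (hM r) (abs_nonneg _)
    _ = M * ∑ r, |c r| := by rw [← Finset.sum_mul, mul_comm]
    -- Cauchy–Schwarz over the `Q` residues; the factor `Q` is exactly the one in Parseval's
    -- identity.
    _ ≤ _ := by
        refine mul_le_mul_of_nonneg_left (Real.le_sqrt_of_sq_le ?_) hM0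
        have := sq_sum_le_card_mul_sum_sq (s := (Finset.univ : Finset (ZMod Q)))
          (f := fun r => |c r|)
        simpa [ZMod.card] using this

/-- The exponential of a nonzero residue is bounded away from `1`. -/
theorem le_norm_stdAddChar_sub_one (x : ZMod Q) :
    4 * (x.valMinAbs.natAbs : ℝ) / Q ≤ ‖stdAddChar x - 1‖ := by
  have hQ : (0 : ℝ) < Q := Nat.cast_pos.mpr (NeZero.pos Q)
  have habs : ((x.valMinAbs.natAbs : ℕ) : ℝ) = |(x.valMinAbs : ℝ)| := by
    rw [Nat.cast_natAbs, Int.cast_abs]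
  have hle : |(x.valMinAbs : ℝ)| ≤ Q / 2 := by
    rw [← habs]
    have := natAbs_valMinAbs_le x
    have h2 : 2 * x.valMinAbs.natAbs ≤ Q := by omega
    have h3 : 2 * (x.valMinAbs.natAbs : ℝ) ≤ Q := by exact_mod_cast h2
    linarith
  have he : (stdAddChar x : ℂ) =
      Complex.exp (Complex.I * ((2 * Real.pi * x.valMinAbs / Q : ℝ) : ℂ)) := by
    conv_lhs => rw [← coe_valMinAbs x, stdAddChar_coe]
    congr 1
    push_cast
    ring
  rw [he, Complex.norm_exp_I_mul_ofReal_sub_one, norm_mul, Real.norm_eq_abs, Real.norm_eq_abs]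
  have harg : 2 * Real.pi * (x.valMinAbs : ℝ) / Q / 2 = Real.pi * (x.valMinAbs / Q) := by ring
  -- Jordan's inequality applies because the representative of least absolute value is at most `Q /
  -- 2`, so the half angle is at most `π / 2`.
  have hsin := Real.mul_abs_le_abs_sin (x := Real.pi * ((x.valMinAbs : ℝ) / Q)) (by
    rw [abs_mul, abs_of_pos Real.pi_pos, abs_div, abs_of_pos hQ, div_eq_mul_inv Real.pi]
    refine mul_le_mul_of_nonneg_left ?_ Real.pi_pos.le
    rw [div_le_iff₀ hQ]; linarith)
  rw [harg, habs]
  rw [abs_mul, abs_of_pos Real.pi_pos, abs_div, abs_of_pos hQ] at hsin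
  have : 2 / Real.pi * (Real.pi * (|(x.valMinAbs : ℝ)| / Q)) = 2 * (|(x.valMinAbs : ℝ)| / Q) := by
    field_simp
  rw [this] at hsin
  rw [abs_two]
  calc _ = 2 * (2 * (|(x.valMinAbs : ℝ)| / Q)) := by ring
    _ ≤ _ := by linarith

theorem stdAddChar_natCast_mul (a : ℕ) (x : ZMod Q) :
    (stdAddChar ((a : ZMod Q) * x) : ℂ) = stdAddChar x ^ a := by
  rw [← nsmul_eq_mul, AddChar.map_nsmul_eq_pow]

theorem norm_sum_stdAddChar_le_card (n : ℕ) (y : ℕ → ZMod Q) :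
    ‖∑ a ∈ Finset.range n, (stdAddChar (y a) : ℂ)‖ ≤ n := by
  refine (norm_sum_le _ _).trans ?_
  simp

/-- The bound for linear exponential sums. -/
theorem norm_sum_stdAddChar_mul_le (n : ℕ) {x : ZMod Q} (hx : x ≠ 0) :
    ‖∑ a ∈ Finset.range n, (stdAddChar ((a : ZMod Q) * x) : ℂ)‖ ≤
      Q / (2 * (x.valMinAbs.natAbs : ℝ)) := by
  have hQ : (0 : ℝ) < Q := Nat.cast_pos.mpr (NeZero.pos Q)
  have hv : (0 : ℝ) < x.valMinAbs.natAbs := by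
    rw [Nat.cast_pos, Int.natAbs_pos, Ne, valMinAbs_eq_zero]; exact hx
  have hlow := le_norm_stdAddChar_sub_one x
  have hpos : 0 < ‖(stdAddChar x : ℂ) - 1‖ := lt_of_lt_of_le (by positivity) hlow
  simp only [stdAddChar_natCast_mul]
  have hne : (stdAddChar x : ℂ) ≠ 1 := by
    intro h; rw [h] at hpos; simp at hpos
  rw [geom_sum_eq hne, norm_div, div_le_div_iff₀ hpos (by positivity)]
  have hnum : ‖(stdAddChar x : ℂ) ^ n - 1‖ ≤ 2 := by
    refine (norm_sub_le _ _).trans ?_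
    rw [norm_pow, norm_stdAddChar]; norm_num
  have h4 : 4 * (x.valMinAbs.natAbs : ℝ) ≤ Q * ‖(stdAddChar x : ℂ) - 1‖ := by
    rw [div_le_iff₀ hQ] at hlow; linarith
  calc _ ≤ 2 * (2 * (x.valMinAbs.natAbs : ℝ)) := by gcongr
    _ ≤ _ := by linarith

end ExponentialSums

/-! ### Weyl differencing for quadratic sums -/

section WeylSums

open ZMod

/-- The inequality behind Weyl differencing. -/
theorem norm_sum_sq_le_sum_norm_correlation (z : ℕ → ℂ) (n : ℕ) :
    ‖∑ a ∈ Finset.range n, z a‖ ^ 2 ≤ 2 * ∑ h ∈ Finset.range n,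
      ‖∑ a ∈ Finset.range (n - h), z (h + a) * (starRingEnd ℂ) (z a)‖ := by
  -- Expanding the square pairs `(m, a)` with `(a, m)`. The right side counts the diagonal twice,
  -- and this nonnegative surplus gives the inequality.
  have h1 : ∀ n, ‖∑ a ∈ Finset.range n, z a‖ ^ 2 ≤ 2 * (∑ m ∈ Finset.range n,
      ∑ a ∈ Finset.range (m + 1), z m * (starRingEnd ℂ) (z a)).re := by
    intro n
    induction n with
    | zero => simp
    | succ n ih =>
      rw [Finset.sum_range_succ, Finset.sum_range_succ _ n, Complex.add_re,
        ← Complex.normSq_eq_norm_sq, Complex.normSq_add, Complex.normSq_eq_norm_sq,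
        Finset.sum_range_succ (fun a => z n * (starRingEnd ℂ) (z a)), ← Finset.mul_sum, ← map_sum,
        Complex.add_re, Complex.mul_conj, Complex.ofReal_re]
      have h2 : ((∑ a ∈ Finset.range n, z a) * (starRingEnd ℂ) (z n)).re =
          (z n * (starRingEnd ℂ) (∑ a ∈ Finset.range n, z a)).re := by
        rw [← Complex.conj_re, map_mul, Complex.conj_conj, mul_comm]
      have := Complex.normSq_nonneg (z n)
      linarith
  have h3 : ∑ m ∈ Finset.range n, ∑ a ∈ Finset.range (m + 1), z m * (starRingEnd ℂ) (z a) =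
      ∑ h ∈ Finset.range n, ∑ a ∈ Finset.range (n - h), z (h + a) * (starRingEnd ℂ) (z a) := by
    rw [← Finset.sum_range_diag_flip n (fun h a => z (h + a) * (starRingEnd ℂ) (z a))]
    refine Finset.sum_congr rfl fun m _ => ?_
    rw [← Finset.sum_range_reflect]
    refine Finset.sum_congr rfl fun a ha => ?_
    have ha' : a < m + 1 := Finset.mem_range.mp ha
    rw [show a + (m - a) = m by omega, show m + 1 - 1 - a = m - a by omega]
  refine (h1 n).trans ?_
  rw [h3]
  gcongr
  exact (Complex.re_le_norm _).trans (norm_sum_le _ _)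

/-- A family of distinct nonzero integers takes each absolute value at most twice. -/
theorem sum_natAbs_le_two_mul_sum {ι : Type*} (s : Finset ι) (w : ι → ℤ)
    (hinj : Set.InjOn w s) (hw : ∀ i ∈ s, w i ≠ 0) {n : ℕ} (hn : ∀ i ∈ s, (w i).natAbs ≤ n)
    {F : ℕ → ℝ} (hF : ∀ j, 0 ≤ F j) :
    ∑ i ∈ s, F (w i).natAbs ≤ 2 * ∑ j ∈ Finset.Icc 1 n, F j := by
  classical
  rw [← Finset.sum_fiberwise_of_maps_to (s := s) (t := Finset.Icc 1 n)
    (g := fun i => (w i).natAbs), Finset.mul_sum]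
  · refine Finset.sum_le_sum fun j _ => ?_
    rw [Finset.sum_congr rfl (g := fun _ => F j), Finset.sum_const, nsmul_eq_mul]
    · refine mul_le_mul_of_nonneg_right ?_ (hF j)
      have hcard : (s.filter fun i => (w i).natAbs = j).card ≤ ({(j : ℤ), -(j : ℤ)} : Finset ℤ).card := by
        refine Finset.card_le_card_of_injOn w ?_ ?_
        · intro i hi
          have := (Finset.mem_filter.mp hi).2
          simp only [Finset.coe_insert, Finset.coe_singleton, Set.mem_insert_iff,
            Set.mem_singleton_iff]
          omega
        · exact hinj.mono fun i hi => (Finset.mem_filter.mp hi).1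
      exact_mod_cast hcard.trans Finset.card_le_two
    · intro i hi
      rw [(Finset.mem_filter.mp hi).2]
  · intro i hi
    rw [Finset.mem_Icc]
    exact ⟨Int.natAbs_pos.mpr (hw i hi), hn i hi⟩

/-- At most `n / m + 1` full periods cover `[0, n)`, and nonnegativity allows the last one to be
completed. -/
theorem sum_range_le_of_periodic {P : ℕ → ℝ} (hP : ∀ h, 0 ≤ P h) {m : ℕ} (hm : 0 < m)
    (hper : ∀ h, P (h + m) = P h) (n : ℕ) :
    ∑ h ∈ Finset.range n, P h ≤ ((n : ℝ) / m + 1) * ∑ h ∈ Finset.range m, P h := by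
  have hper' : ∀ u h, P (m * u + h) = P h := by
    intro u h
    induction u with
    | zero => simp
    | succ u ih => rw [← ih, ← hper (m * u + h)]; congr 1; ring
  have h1 : ∀ u : ℕ, ∑ h ∈ Finset.range (m * u), P h = u * ∑ h ∈ Finset.range m, P h := by
    intro u
    induction u with
    | zero => simp
    | succ u ih =>
      rw [Nat.mul_succ, Finset.sum_range_add, ih]
      simp only [hper']
      push_cast; ring
  have hle : n ≤ m * (n / m + 1) := (Nat.lt_mul_div_succ n hm).le
  calc ∑ h ∈ Finset.range n, P h ≤ ∑ h ∈ Finset.range (m * (n / m + 1)), P h :=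
        Finset.sum_le_sum_of_subset_of_nonneg (Finset.range_mono hle) fun h _ _ => hP h
    _ = ((n / m : ℕ) + 1 : ℝ) * ∑ h ∈ Finset.range m, P h := by rw [h1]; push_cast; ring
    _ ≤ _ := by
        refine mul_le_mul_of_nonneg_right ?_ (Finset.sum_nonneg fun h _ => hP h)
        have := Nat.cast_div_le (α := ℝ) (m := n) (n := m)
        linarith

variable {Q : ℕ} [NeZero Q]

/-- The sum of the bounds for the linear exponential sums with frequencies the multiples of `y`. -/
theorem sum_multiples_le (y : ZMod Q) {A : ℝ} (hA : 0 ≤ A) (n : ℕ) {m : ℕ}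
    (hm : m = Q / Nat.gcd Q y.val) :
    ∑ h ∈ Finset.range n, (if (h : ZMod Q) * y = 0 then A else
      Q / (2 * (((h : ZMod Q) * y).valMinAbs.natAbs : ℝ))) ≤
      ((n : ℝ) / m + 1) * (A + m * (1 + Real.log m)) := by
  have hQ : 0 < Q := NeZero.pos Q
  set g := Nat.gcd Q y.val with hg
  have hg0 : 0 < g := Nat.gcd_pos_of_pos_left _ hQ
  have hgm : g * m = Q := by rw [hm]; exact Nat.mul_div_cancel' (Nat.gcd_dvd_left _ _)
  have hm0 : 0 < m := Nat.pos_of_ne_zero fun h => by simp [h] at hgm; omega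
  -- `m` is the additive order of `y`: the multiples `h y` with `0 < h < m` are distinct, nonzero,
  -- and all divisible by `g`.
  have hinj : ∀ a b : ℕ, (a : ZMod Q) * y = b * y → a ≡ b [MOD m] := by
    intro a b hab
    rw [hm]
    refine Nat.ModEq.cancel_right_div_gcd hQ ?_
    rw [← ZMod.natCast_eq_natCast_iff]
    push_cast
    rwa [ZMod.natCast_zmod_val]
  have hmy : (m : ZMod Q) * y = 0 := by
    rw [← ZMod.natCast_zmod_val y, ← Nat.cast_mul, ZMod.natCast_eq_zero_iff]
    obtain ⟨c, hc⟩ : g ∣ y.val := Nat.gcd_dvd_right _ _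
    exact ⟨c, by rw [hc, ← hgm]; ring⟩
  have hdvd : ∀ h : ℕ, (g : ℤ) ∣ ((h : ZMod Q) * y).valMinAbs := by
    intro h
    have h1 : ((((h : ZMod Q) * y).valMinAbs - (h * y.val : ℕ) : ℤ) : ZMod Q) = 0 := by
      push_cast
      rw [ZMod.natCast_zmod_val, sub_self]
    rw [ZMod.intCast_zmod_eq_zero_iff_dvd] at h1
    have h2 : (g : ℤ) ∣ (Q : ℤ) := Int.natCast_dvd_natCast.mpr (Nat.gcd_dvd_left _ _)
    have h3 : (g : ℤ) ∣ ((h * y.val : ℕ) : ℤ) :=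
      Int.natCast_dvd_natCast.mpr ((Nat.gcd_dvd_right _ _).mul_left _)
    have := (h2.trans h1).add h3
    simpa using this
  choose w hw using hdvd
  refine (sum_range_le_of_periodic (fun h => ?_) hm0 (fun h => ?_) n).trans ?_
  · split_ifs <;> positivity
  · have : ((h + m : ℕ) : ZMod Q) * y = h * y := by push_cast; rw [add_mul, hmy, add_zero]
    rw [this]
  refine mul_le_mul_of_nonneg_left ?_ (by positivity)
  obtain ⟨m', rfl⟩ : ∃ m', m = m' + 1 := ⟨m - 1, by omega⟩
  rw [Finset.sum_range_succ']
  simp only [Nat.cast_zero, zero_mul, if_true]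
  rw [add_comm A]
  gcongr
  have hne : ∀ h ∈ Finset.range m', ((h + 1 : ℕ) : ZMod Q) * y ≠ 0 := by
    intro h hh h0
    have h1 := hinj (h + 1) 0 (by rw [h0]; simp)
    rw [Nat.modEq_zero_iff_dvd] at h1
    have := Nat.le_of_dvd (Nat.succ_pos h) h1
    have := Finset.mem_range.mp hh
    omega
  have hgR : (0 : ℝ) < g := Nat.cast_pos.mpr hg0
  have hsum : ∑ h ∈ Finset.range m', (if ((h + 1 : ℕ) : ZMod Q) * y = 0 then A else
      Q / (2 * ((((h + 1 : ℕ) : ZMod Q) * y).valMinAbs.natAbs : ℝ))) =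
      ∑ h ∈ Finset.range m', (((m' + 1 : ℕ) : ℝ) / 2) * ((w (h + 1)).natAbs : ℝ)⁻¹ := by
    refine Finset.sum_congr rfl fun h hh => ?_
    rw [if_neg (hne h hh), hw, Int.natAbs_mul, Int.natAbs_natCast, ← hgm]
    push_cast
    have : (w (h + 1)).natAbs ≠ 0 := by
      intro h0
      refine hne h hh ?_
      rw [← valMinAbs_eq_zero, hw, Int.natAbs_eq_zero.mp h0, mul_zero]
    have h' : ((w (h + 1)).natAbs : ℝ) ≠ 0 := Nat.cast_ne_zero.mpr this
    field_simp
  rw [hsum, ← Finset.mul_sum]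
  -- After division by `g`, the terms are `(m / 2) / |w|` for distinct nonzero integers `w`. Each
  -- absolute value occurs at most twice, which cancels the `1 / 2` and leaves a harmonic sum.
  have hkey := sum_natAbs_le_two_mul_sum (Finset.range m') (fun h => w (h + 1)) (n := m' + 1)
    (F := fun j => (j : ℝ)⁻¹) ?_ ?_ ?_ (fun j => by positivity)
  · have hharm := harmonic_le_one_add_log (m' + 1)
    rw [harmonic_eq_sum_Icc] at hharm
    push_cast at hharm ⊢
    calc _ ≤ (((m' : ℝ) + 1) / 2) * (2 * ∑ j ∈ Finset.Icc 1 (m' + 1), (j : ℝ)⁻¹) := by gcongr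
      _ = ((m' : ℝ) + 1) * ∑ j ∈ Finset.Icc 1 (m' + 1), (j : ℝ)⁻¹ := by ring
      _ ≤ _ := by gcongr
  · intro a ha b hb hab
    simp only at hab
    have h1 := hinj (a + 1) (b + 1) (injective_valMinAbs (by rw [hw, hw, hab]))
    have ha' : a < m' := by simpa using ha
    have hb' : b < m' := by simpa using hb
    have := Nat.ModEq.eq_of_lt_of_lt h1 (by omega) (by omega)
    omega
  · intro h hh h0
    refine hne h hh ?_
    rw [← valMinAbs_eq_zero, hw, h0, mul_zero]
  · intro h _
    have h1 := natAbs_valMinAbs_le (((h + 1 : ℕ) : ZMod Q) * y)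
    rw [hw, Int.natAbs_mul, Int.natAbs_natCast] at h1
    have h2 : g * (w (h + 1)).natAbs ≤ g * (m' + 1) := by rw [hgm]; omega
    exact Nat.le_of_mul_le_mul_left h2 hg0

/-- Weyl's inequality for quadratic exponential sums modulo `Q`. -/
theorem norm_quadratic_sum_sq_le (k c : ZMod Q) (n : ℕ) {m : ℕ}
    (hm : m = Q / Nat.gcd Q (2 * k).val) :
    ‖∑ a ∈ Finset.range n, (stdAddChar (k * ((a : ZMod Q) ^ 2 + c * (a : ZMod Q))) : ℂ)‖ ^ 2 ≤
      2 * (((n : ℝ) / m + 1) * (n + m * (1 + Real.log m))) := by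
  refine (norm_sum_sq_le_sum_norm_correlation _ n).trans ?_
  refine mul_le_mul_of_nonneg_left ?_ (by norm_num)
  refine le_trans (Finset.sum_le_sum fun h _ => ?_)
    (sum_multiples_le (2 * k) (Nat.cast_nonneg n) n hm)
  -- Differencing removes the quadratic term: up to a factor of modulus one independent of `a`, the
  -- phase is linear in `a` with frequency `h (2k)`.
  have h1 : ∀ a : ℕ,
      (stdAddChar (k * (((h + a : ℕ) : ZMod Q) ^ 2 + c * ((h + a : ℕ) : ZMod Q))) : ℂ) *
        (starRingEnd ℂ) (stdAddChar (k * ((a : ZMod Q) ^ 2 + c * (a : ZMod Q)))) =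
      stdAddChar (k * ((h : ZMod Q) ^ 2 + c * (h : ZMod Q))) *
        stdAddChar ((a : ZMod Q) * ((h : ZMod Q) * (2 * k))) := by
    intro a
    rw [conj_stdAddChar, ← AddChar.map_add_eq_mul, ← AddChar.map_add_eq_mul]
    congr 1
    push_cast
    ring
  simp only [h1]
  rw [← Finset.mul_sum, norm_mul, norm_stdAddChar, one_mul]
  split_ifs with h0
  · refine (norm_sum_stdAddChar_le_card _ _).trans ?_
    exact_mod_cast Nat.sub_le n h
  · exact norm_sum_stdAddChar_mul_le _ h0

end WeylSums

/-! ### Equidistribution of `a^2 + 2ba + tq` modulo `Q` -/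

section Equidistribution

open ZMod

variable {Q : ℕ} [NeZero Q]

/-- Weyl's inequality at a frequency `k` for which `k * q` is close to `0`. -/
theorem norm_quadratic_sum_sq_le_of_natAbs_le (k c : ZMod Q) (q B : ℕ) {K : ℕ}
    (hx : k * q ≠ 0) (hK : (k * q).valMinAbs.natAbs ≤ K) :
    ‖∑ a ∈ Finset.range B, (stdAddChar (k * ((a : ZMod Q) ^ 2 + c * (a : ZMod Q))) : ℂ)‖ ^ 2 ≤
      2 * (2 * K * B ^ 2 / Q + B * (2 + Real.log Q) + Q * (1 + Real.log Q)) := by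
  have hQ : 0 < Q := NeZero.pos Q
  have hQR : (0 : ℝ) < Q := Nat.cast_pos.mpr hQ
  set g := Nat.gcd Q (2 * k).val with hg
  have hgQ : g ∣ Q := Nat.gcd_dvd_left _ _
  have hg0 : 0 < g := Nat.gcd_pos_of_pos_left _ hQ
  -- `g` divides `Q` and `2k`, hence divides twice the least representative of `k q`, a nonzero
  -- integer of size at most `2K`. So the reduced denominator `Q / g` is at least `Q / (2K)`.
  have hgK : g ≤ 2 * K := by
    have h1 : (((2 * k).val * q - 2 * (k * q).valMinAbs : ℤ) : ZMod Q) = 0 := by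
      push_cast
      rw [ZMod.natCast_zmod_val]
      ring
    rw [ZMod.intCast_zmod_eq_zero_iff_dvd] at h1
    have h2 : (g : ℤ) ∣ (Q : ℤ) := Int.natCast_dvd_natCast.mpr hgQ
    have h3 : (g : ℤ) ∣ (((2 * k).val : ℕ) : ℤ) * q :=
      (Int.natCast_dvd_natCast.mpr (Nat.gcd_dvd_right _ _)).mul_right _
    have h4 : (g : ℤ) ∣ 2 * (k * q).valMinAbs := by
      have := h3.sub (h2.trans h1)
      simpa using this
    have h5 : (2 * (k * q).valMinAbs) ≠ 0 := by
      simpa [valMinAbs_eq_zero] using hx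
    have h6 := Nat.le_of_dvd (Int.natAbs_pos.mpr h5) (Int.natCast_dvd.mp h4)
    omega
  obtain ⟨m, hm⟩ : ∃ m, m = Q / g := ⟨_, rfl⟩
  have hgm : g * m = Q := by rw [hm]; exact Nat.mul_div_cancel' hgQ
  have hm0 : 0 < m := Nat.pos_of_ne_zero fun h => by simp [h] at hgm; omega
  have hmR : (1 : ℝ) ≤ m := by exact_mod_cast hm0
  have hmQ : (m : ℝ) ≤ Q := by rw [hm]; exact_mod_cast Nat.div_le_self _ _
  have hlog : Real.log m ≤ Real.log Q := Real.log_le_log (by linarith) hmQ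
  have hlog0 : 0 ≤ Real.log m := Real.log_nonneg hmR
  have hdiv : (1 : ℝ) / m ≤ 2 * K / Q := by
    rw [div_le_div_iff₀ (by linarith) hQR, one_mul]
    have : Q ≤ 2 * K * m := hgm ▸ Nat.mul_le_mul_right m hgK
    exact_mod_cast this
  refine (norm_quadratic_sum_sq_le k c B hm).trans ?_
  refine mul_le_mul_of_nonneg_left ?_ (by norm_num)
  have hB : (0 : ℝ) ≤ B := Nat.cast_nonneg B
  calc ((B : ℝ) / m + 1) * (B + m * (1 + Real.log m))
      = (B : ℝ) ^ 2 * (1 / m) + B * (2 + Real.log m) + m * (1 + Real.log m) := by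
        field_simp; ring
    _ ≤ (B : ℝ) ^ 2 * (2 * K / Q) + B * (2 + Real.log Q) + Q * (1 + Real.log Q) := by
        gcongr
    _ = _ := by ring

/-- The second moment of the exponential sums over the family `a ^ 2 + c a + t q`. -/
theorem sum_norm_quadratic_sum_sq_le (c : ZMod Q) {q : ℕ} (hq : q.Coprime Q) (B L : ℕ) {K : ℕ}
    (hK : 0 < K) :
    ∑ k ∈ Finset.univ.erase (0 : ZMod Q), ‖∑ i ∈ Finset.range B ×ˢ Finset.range L,
      (stdAddChar (k * ((i.1 : ZMod Q) ^ 2 + c * (i.1 : ZMod Q) + (i.2 : ZMod Q) * (q : ZMod Q))) : ℂ)‖ ^ 2 ≤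
      2 * K * (2 * (2 * K * B ^ 2 / Q + B * (2 + Real.log Q) + Q * (1 + Real.log Q))) * L ^ 2 +
        B ^ 2 * Q ^ 2 / (2 * K) := by
  have hQ : 0 < Q := NeZero.pos Q
  have hQR : (1 : ℝ) ≤ Q := by exact_mod_cast hQ
  have hlog0 : 0 ≤ Real.log Q := Real.log_nonneg hQR
  have hKR : (0 : ℝ) < K := Nat.cast_pos.mpr hK
  set W : ℝ := 2 * (2 * K * B ^ 2 / Q + B * (2 + Real.log Q) + Q * (1 + Real.log Q)) with hW
  have hW0 : 0 ≤ W := by positivity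
  -- A majorant in terms of `j = |k q|`: for `j ≤ K`, Weyl's bound times the trivial bound `L`; for
  -- `j > K`, the trivial bound `B` times the geometric sum bound.
  let F : ℕ → ℝ := fun j =>
    if j ≤ K then W * L ^ 2 else B ^ 2 * Q ^ 2 / 4 * ((j : ℝ) ^ 2)⁻¹
  have hF : ∀ j, 0 ≤ F j := by
    intro j
    simp only [F]
    split_ifs <;> positivity
  have hunit : IsUnit (q : ZMod Q) := (ZMod.isUnit_iff_coprime q Q).mpr hq
  have hne : ∀ k ∈ Finset.univ.erase (0 : ZMod Q), k * q ≠ 0 := by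
    intro k hk h0
    exact Finset.ne_of_mem_erase hk (hunit.mul_left_eq_zero.mp h0)
  have hterm : ∀ k ∈ Finset.univ.erase (0 : ZMod Q),
      ‖∑ i ∈ Finset.range B ×ˢ Finset.range L,
      (stdAddChar (k * ((i.1 : ZMod Q) ^ 2 + c * (i.1 : ZMod Q) + (i.2 : ZMod Q) * (q : ZMod Q))) : ℂ)‖ ^ 2 ≤
      F (k * q).valMinAbs.natAbs := by
    intro k hk
    have hfac : ∑ i ∈ Finset.range B ×ˢ Finset.range L,
        (stdAddChar (k * ((i.1 : ZMod Q) ^ 2 + c * (i.1 : ZMod Q) + (i.2 : ZMod Q) * (q : ZMod Q))) : ℂ) =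
        (∑ a ∈ Finset.range B, (stdAddChar (k * ((a : ZMod Q) ^ 2 + c * (a : ZMod Q))) : ℂ)) *
        ∑ t ∈ Finset.range L, (stdAddChar ((t : ZMod Q) * (k * (q : ZMod Q))) : ℂ) := by
      rw [Finset.sum_mul_sum, Finset.sum_product]
      refine Finset.sum_congr rfl fun a _ => Finset.sum_congr rfl fun t _ => ?_
      rw [← AddChar.map_add_eq_mul]
      congr 1
      ring
    rw [hfac, norm_mul, mul_pow]
    simp only [F]
    split_ifs with hj
    · refine mul_le_mul (norm_quadratic_sum_sq_le_of_natAbs_le k c q B (hne k hk) hj) ?_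
        (by positivity) hW0
      gcongr
      exact norm_sum_stdAddChar_le_card _ _
    · have h1 := norm_sum_stdAddChar_le_card B
        (fun a => k * ((a : ZMod Q) ^ 2 + c * (a : ZMod Q)))
      have h2 := norm_sum_stdAddChar_mul_le L (hne k hk)
      calc _ ≤ (B : ℝ) ^ 2 * (Q / (2 * ((k * q).valMinAbs.natAbs : ℝ))) ^ 2 := by gcongr
        _ = _ := by rw [div_pow, mul_pow]; ring
  calc _ ≤ ∑ k ∈ Finset.univ.erase (0 : ZMod Q), F (k * q).valMinAbs.natAbs :=
        Finset.sum_le_sum hterm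
    _ ≤ 2 * ∑ j ∈ Finset.Icc 1 Q, F j := by
        refine sum_natAbs_le_two_mul_sum _ (fun k : ZMod Q => (k * q).valMinAbs) ?_ ?_ ?_ hF
        · intro k _ l _ hkl
          exact hunit.mul_left_injective (injective_valMinAbs hkl)
        · intro k hk h0
          exact hne k hk ((valMinAbs_eq_zero _).mp h0)
        · intro k _
          exact (natAbs_valMinAbs_le _).trans (Nat.div_le_self _ _)
    -- The endpoint `max K Q` avoids having to assume `K ≤ Q`.
    _ ≤ 2 * (∑ j ∈ Finset.Icc 1 K, F j + ∑ j ∈ Finset.Ioc K (max K Q), F j) := by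
        rw [← Finset.sum_union]
        · refine mul_le_mul_of_nonneg_left ?_ (by norm_num)
          refine Finset.sum_le_sum_of_subset_of_nonneg (fun j hj => ?_) fun j _ _ => hF j
          rw [Finset.mem_Icc] at hj
          rw [Finset.mem_union, Finset.mem_Icc, Finset.mem_Ioc]
          rcases le_or_gt j K with h | h
          · exact Or.inl ⟨hj.1, h⟩
          · exact Or.inr ⟨h, hj.2.trans (le_max_right _ _)⟩
        · rw [Finset.disjoint_left]
          intro j hj hj'
          rw [Finset.mem_Icc] at hj
          rw [Finset.mem_Ioc] at hj'
          omega
    _ ≤ 2 * (K * (W * L ^ 2) + B ^ 2 * Q ^ 2 / 4 * (K : ℝ)⁻¹) := by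
        gcongr
        · refine (Finset.sum_le_card_nsmul _ _ (W * L ^ 2) fun j hj => ?_).trans_eq ?_
          · simp only [F, if_pos (Finset.mem_Icc.mp hj).2, le_refl]
          · simp
        · calc _ = ∑ j ∈ Finset.Ioc K (max K Q), (B : ℝ) ^ 2 * Q ^ 2 / 4 * ((j : ℝ) ^ 2)⁻¹ := by
                refine Finset.sum_congr rfl fun j hj => ?_
                simp only [F, if_neg (not_le.mpr (Finset.mem_Ioc.mp hj).1)]
            _ = (B : ℝ) ^ 2 * Q ^ 2 / 4 * ∑ j ∈ Finset.Ioc K (max K Q), ((j : ℝ) ^ 2)⁻¹ := by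
                rw [Finset.mul_sum]
            _ ≤ _ := by
                gcongr
                have := sum_Ioc_inv_sq_le_sub (α := ℝ) hK.ne' (le_max_left K Q)
                have h0 : (0 : ℝ) ≤ ((max K Q : ℕ) : ℝ)⁻¹ := by positivity
                linarith
    _ = _ := by field_simp; ring

/-- A sequence that is almost periodic with two coprime periods `q < Q`, over `L` consecutive
multiples of each, is equidistributed along quadratic progressions. -/
theorem abs_sum_quadratic_sub_average_le {g : ℕ → ℝ} {M ε : ℝ} (hM : ∀ s, |g s| ≤ M)
    {q : ℕ} (hq : q.Coprime Q) (hqQ : q < Q) {L : ℕ} (hL : 0 < L)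
    (hgq : ∀ s t, t < L → |g (s + t * q) - g s| ≤ ε)
    (hgQ : ∀ s t, t < L → |g (s + t * Q) - g s| ≤ ε) {b B K : ℕ}
    (hB : B ^ 2 + 2 * b * B ≤ Q * L) (hK : 0 < K) :
    |∑ a ∈ Finset.range B, g (a ^ 2 + 2 * b * a) -
      (B : ℝ) / Q * ∑ r ∈ Finset.range Q, g r| ≤ B * (3 * ε) +
      M * √(2 * K * (2 * (2 * K * B ^ 2 / Q + B * (2 + Real.log Q) + Q * (1 + Real.log Q))) * L ^ 2
        + B ^ 2 * Q ^ 2 / (2 * K)) / L := by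
  have hQ : 0 < Q := NeZero.pos Q
  have hLR : (0 : ℝ) < L := Nat.cast_pos.mpr hL
  have hM0 : 0 ≤ M := (abs_nonneg _).trans (hM 0)
  have hmod : ∀ n t, t < L → n < (t + 1) * Q → |g n - g (n % Q)| ≤ ε := by
    intro n t ht hn
    have h1 := hgQ (n % Q) (n / Q) (by
      have : n / Q < t + 1 := Nat.div_lt_of_lt_mul (by rwa [mul_comm])
      omega)
    rwa [mul_comm (n / Q), Nat.mod_add_div] at h1
  let G : ZMod Q → ℝ := fun r => g r.val
  let x : ℕ → ZMod Q := fun a => (a : ZMod Q) ^ 2 + (2 * b : ZMod Q) * (a : ZMod Q)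
  have hGx : ∀ a ∈ Finset.range B, |g (a ^ 2 + 2 * b * a) - G (x a)| ≤ ε := by
    intro a ha
    have ha' : a < B := Finset.mem_range.mp ha
    have hx : x a = ((a ^ 2 + 2 * b * a : ℕ) : ZMod Q) := by simp only [x]; push_cast; ring
    simp only [G]
    rw [hx, ZMod.val_natCast]
    -- The largest admissible multiple, `L - 1`, turns the size condition into `n < L * Q`.
    refine hmod _ (L - 1) (by omega) ?_
    rw [Nat.sub_add_cancel hL, mul_comm L]
    refine lt_of_lt_of_le ?_ hB
    have h1 : a ^ 2 < B ^ 2 := Nat.pow_lt_pow_left ha' (by norm_num)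
    have h2 : 2 * b * a ≤ 2 * b * B := Nat.mul_le_mul_left _ ha'.le
    omega
  -- One `ε` pays for the shift by `t q`, the other for reduction modulo `Q`. Since `q < Q`, the
  -- reduction removes at most `t` copies of `Q`.
  have hGt : ∀ r : ZMod Q, ∀ t < L, |G r - G (r + (t : ZMod Q) * q)| ≤ 2 * ε := by
    intro r t ht
    have hr : r + (t : ZMod Q) * q = ((r.val + t * q : ℕ) : ZMod Q) := by
      push_cast
      rw [ZMod.natCast_zmod_val]
    simp only [G]
    rw [hr, ZMod.val_natCast]
    have h1 := hgq r.val t ht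
    have h2 := hmod (r.val + t * q) t ht (by
      have := ZMod.val_lt r
      have h3 : t * q ≤ t * Q := Nat.mul_le_mul_left _ hqQ.le
      rw [add_mul, one_mul]
      omega)
    have h3 := abs_sub_le (g r.val) (g (r.val + t * q)) (g ((r.val + t * q) % Q))
    rw [abs_sub_comm] at h1
    linarith
  have hmain := abs_sum_sub_average_le (Finset.range B ×ˢ Finset.range L)
    (fun i => (i.1 : ZMod Q) ^ 2 + (2 * b : ZMod Q) * (i.1 : ZMod Q) + (i.2 : ZMod Q) * (q : ZMod Q)) G
    (fun r => hM r.val)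
  have hV := mul_le_mul_of_nonneg_left
    (Real.sqrt_le_sqrt (sum_norm_quadratic_sum_sq_le (2 * b : ZMod Q) hq B L hK)) hM0
  have hmain' := hmain.trans hV
  have hsumG : ∑ r, G r = ∑ r ∈ Finset.range Q, g r := by
    refine Finset.sum_bij (fun r _ => r.val) ?_ ?_ ?_ ?_
    · intro r _; exact Finset.mem_range.mpr (ZMod.val_lt r)
    · intro r _ s _ h; exact ZMod.val_injective Q h
    · intro n hn
      exact ⟨n, Finset.mem_univ _, ZMod.val_cast_of_lt (Finset.mem_range.mp hn)⟩
    · intro r _; rfl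
  rw [hsumG, Finset.card_product, Finset.card_range, Finset.card_range] at hmain'
  set E : ℝ := M * √(2 * K * (2 * (2 * K * B ^ 2 / Q + B * (2 + Real.log Q) +
    Q * (1 + Real.log Q))) * L ^ 2 + B ^ 2 * Q ^ 2 / (2 * K)) with hE
  set Sg := ∑ r ∈ Finset.range Q, g r with hSg
  have hA : |∑ a ∈ Finset.range B, g (a ^ 2 + 2 * b * a) - ∑ a ∈ Finset.range B, G (x a)| ≤
      B * ε := by
    rw [← Finset.sum_sub_distrib]
    refine (Finset.abs_sum_le_sum_abs _ _).trans ((Finset.sum_le_sum hGx).trans_eq ?_)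
    simp
  -- Each value is replaced by its average over the `L` shifts `t q`, which creates the
  -- two-parameter family to which Parseval applies.
  have hC : |L * ∑ a ∈ Finset.range B, G (x a) - ∑ i ∈ Finset.range B ×ˢ Finset.range L,
      G ((i.1 : ZMod Q) ^ 2 + (2 * b : ZMod Q) * (i.1 : ZMod Q) + (i.2 : ZMod Q) * (q : ZMod Q))| ≤
      L * (B * (2 * ε)) := by
    have h1 : L * ∑ a ∈ Finset.range B, G (x a) =
        ∑ i ∈ Finset.range B ×ˢ Finset.range L, G (x i.1) := by
      rw [Finset.sum_product, Finset.mul_sum]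
      simp
    rw [h1, ← Finset.sum_sub_distrib]
    refine (Finset.abs_sum_le_sum_abs _ _).trans
      ((Finset.sum_le_sum (g := fun _ => 2 * ε) fun i hi => ?_).trans_eq ?_)
    · exact hGt _ _ (Finset.mem_range.mp (Finset.mem_product.mp hi).2)
    · simp; ring
  have hD : |L * ∑ a ∈ Finset.range B, G (x a) - L * ((B : ℝ) / Q * Sg)| ≤
      L * (B * (2 * ε)) + E := by
    have h1 := abs_sub_le (L * ∑ a ∈ Finset.range B, G (x a))
      (∑ i ∈ Finset.range B ×ˢ Finset.range L,
      G ((i.1 : ZMod Q) ^ 2 + (2 * b : ZMod Q) * (i.1 : ZMod Q) + (i.2 : ZMod Q) * (q : ZMod Q)))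
      (L * ((B : ℝ) / Q * Sg))
    have h2 : L * ((B : ℝ) / Q * Sg) = ((B * L : ℕ) : ℝ) / Q * Sg := by push_cast; ring
    rw [h2] at h1 ⊢
    linarith
  rw [← mul_sub, abs_mul, abs_of_pos hLR, ← le_div_iff₀' hLR] at hD
  have hD' : |∑ a ∈ Finset.range B, G (x a) - (B : ℝ) / Q * Sg| ≤ B * (2 * ε) + E / L := by
    refine hD.trans_eq ?_
    field_simp
  have h1 := abs_sub_le (∑ a ∈ Finset.range B, g (a ^ 2 + 2 * b * a))
    (∑ a ∈ Finset.range B, G (x a)) ((B : ℝ) / Q * Sg)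
  linarith

/-- Here `x` stands for `Q` and `l` for `log Q`. The target is `(B L)^2 = r^124`, so a bound of
order `r^123` saves a factor `r`. The Weyl part gives `18 + 41 + 64 = 123`, where `41` is the `40`
of `Q` plus one power spent on the logarithm; the geometric part gives only `60 + 80 - 18 = 122`. -/
theorem second_moment_parameters_le {r c x l : ℝ} (hr : 1 ≤ r) (hxl : r ^ 40 ≤ x)
    (hxu : x ≤ c * r ^ 40) (hl0 : 0 ≤ l) (hl : l ≤ 80 * r) :
    2 * r ^ 18 * (2 * (2 * r ^ 18 * (r ^ 30) ^ 2 / x + r ^ 30 * (2 + l) + x * (1 + l))) *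
      (r ^ 32) ^ 2 + (r ^ 30) ^ 2 * x ^ 2 / (2 * r ^ 18) ≤
      (4 * (84 + 81 * c) + c ^ 2) * r ^ 123 := by
  have hr0 : 0 < r := by linarith
  have hx0 : 0 < x := lt_of_lt_of_le (by positivity) hxl
  have hc0 : 0 ≤ c := by
    by_contra h
    push Not at h
    have := mul_neg_of_neg_of_pos h (pow_pos hr0 40)
    linarith
  have hp1 : r ^ 38 ≤ r ^ 41 := pow_le_pow_right₀ hr (by norm_num)
  have hp2 : r ^ 30 ≤ r ^ 40 := pow_le_pow_right₀ hr (by norm_num)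
  have ha : 2 * r ^ 18 * (r ^ 30) ^ 2 / x ≤ 2 * r ^ 41 := by
    rw [div_le_iff₀ hx0]
    calc 2 * r ^ 18 * (r ^ 30) ^ 2 = 2 * (r ^ 38 * r ^ 40) := by ring
      _ ≤ 2 * (r ^ 41 * x) := by gcongr 2 * (?_ * ?_)
      _ = _ := by ring
  have hb : r ^ 30 * (2 + l) ≤ 82 * r ^ 41 := by
    calc r ^ 30 * (2 + l) ≤ r ^ 40 * (82 * r) := by
          gcongr ?_ * ?_
          linarith
      _ = _ := by ring
  have hcc : x * (1 + l) ≤ 81 * c * r ^ 41 := by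
    calc x * (1 + l) ≤ (c * r ^ 40) * (81 * r) := by
          gcongr ?_ * ?_
          linarith
      _ = _ := by ring
  have hd : (r ^ 30) ^ 2 * x ^ 2 / (2 * r ^ 18) ≤ c ^ 2 * r ^ 123 := by
    rw [div_le_iff₀ (by positivity)]
    calc (r ^ 30) ^ 2 * x ^ 2 ≤ (r ^ 30) ^ 2 * (c * r ^ 40) ^ 2 := by gcongr
      _ = c ^ 2 * (r ^ 140 * 1) := by ring
      _ ≤ c ^ 2 * (r ^ 140 * (2 * r)) := by gcongr; linarith
      _ = _ := by ring
  calc _ ≤ 2 * r ^ 18 * (2 * (2 * r ^ 41 + 82 * r ^ 41 + 81 * c * r ^ 41)) * (r ^ 32) ^ 2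
        + c ^ 2 * r ^ 123 := by gcongr
    _ = _ := by ring

/-- The error term for the choice of parameters `L = R ^ 32`, `B = R ^ 30`, `K = R ^ 18`, where
`R` is the integer part of the fortieth root of `Q`. -/
theorem second_moment_error_le {R Q : ℕ} (hR : 0 < R) (hRQ : R ^ 40 ≤ Q) (hQR : Q < (R + 1) ^ 40) :
    √(2 * (R ^ 18 : ℕ) * (2 * (2 * (R ^ 18 : ℕ) * (R ^ 30 : ℕ) ^ 2 / Q +
      (R ^ 30 : ℕ) * (2 + Real.log Q) + Q * (1 + Real.log Q))) * (R ^ 32 : ℕ) ^ 2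
        + (R ^ 30 : ℕ) ^ 2 * Q ^ 2 / (2 * (R ^ 18 : ℕ))) / (R ^ 32 : ℕ) ≤
      (R ^ 30 : ℕ) * √((4 * (84 + 81 * 2 ^ 40) + (2 ^ 40) ^ 2) / R) := by
  have hr : (1 : ℝ) ≤ R := by exact_mod_cast hR
  have hr0 : (0 : ℝ) < R := by linarith
  have hQl : (R : ℝ) ^ 40 ≤ Q := by exact_mod_cast hRQ
  have hQ0 : (0 : ℝ) < Q := lt_of_lt_of_le (by positivity) hQl
  have hQu : (Q : ℝ) ≤ 2 ^ 40 * (R : ℝ) ^ 40 := by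
    have h1 : (Q : ℝ) ≤ ((R : ℝ) + 1) ^ 40 := by exact_mod_cast hQR.le
    calc (Q : ℝ) ≤ ((R : ℝ) + 1) ^ 40 := h1
      _ ≤ (2 * (R : ℝ)) ^ 40 := by gcongr; linarith
      _ = _ := by rw [mul_pow]
  have hlog : Real.log Q ≤ 80 * R := by
    calc Real.log Q ≤ Real.log ((2 * (R : ℝ)) ^ 40) :=
          Real.log_le_log hQ0 (by rw [mul_pow]; exact hQu)
      _ = 40 * Real.log (2 * R) := by rw [Real.log_pow]; norm_num
      _ ≤ 40 * (2 * R) := by gcongr; exact Real.log_le_self (by positivity)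
      _ = _ := by ring
  have hlog0 : 0 ≤ Real.log Q := Real.log_nonneg (le_trans (one_le_pow₀ hr) hQl)
  have hsum := second_moment_parameters_le hr hQl hQu hlog0 hlog
  have hC : (0 : ℝ) ≤ 4 * (84 + 81 * 2 ^ 40) + (2 ^ 40) ^ 2 := by positivity
  push_cast
  generalize (4 * (84 + 81 * 2 ^ 40) + (2 ^ 40) ^ 2 : ℝ) = C at hsum hC ⊢
  generalize (R : ℝ) = r at *
  rw [div_le_iff₀ (by positivity)]
  refine (Real.sqrt_le_sqrt hsum).trans_eq ?_
  -- `123 = 2 (30 + 32) - 1`: the missing power becomes the decay `C / r` under the root.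
  have : C * r ^ 123 = (r ^ 30 * r ^ 32) ^ 2 * (C / r) := by
    field_simp
  rw [this, Real.sqrt_mul (by positivity), Real.sqrt_sq (by positivity)]
  ring

end Equidistribution

/-! ### From blocks to averages along squares -/

section SquareAverages

/-- Averages over consecutive blocks of length `B` control the average over `[0, N)`. -/
theorem abs_sum_sub_le_of_blocks {h : ℕ → ℝ} {M I η : ℝ} (hM : ∀ i, |h i| ≤ M) (hI : |I| ≤ M)
    (hη : 0 ≤ η) {B N : ℕ} (hB : 0 < B)
    (hblock : ∀ j, (j + 1) * B ≤ N → |∑ a ∈ Finset.range B, h (j * B + a) - B * I| ≤ B * η) :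
    |∑ i ∈ Finset.range N, h i - N * I| ≤ N * η + 2 * M * B := by
  have hM0 : 0 ≤ M := (abs_nonneg _).trans hI
  have h1 : ∀ u : ℕ, u * B ≤ N →
      |∑ i ∈ Finset.range (u * B), h i - (u * B : ℕ) * I| ≤ (u * B : ℕ) * η := by
    intro u
    induction u with
    | zero => simp
    | succ u ih =>
      intro hu
      have h2 := ih (le_trans (Nat.mul_le_mul_right B (Nat.le_succ u)) hu)
      have h3 := hblock u hu
      rw [Nat.succ_mul, Finset.sum_range_add]
      push_cast at h2 ⊢
      rw [abs_le] at *
      constructor <;> linarith [h2.1, h2.2, h3.1, h3.2]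
  have h2 := h1 (N / B) (Nat.div_mul_le_self N B)
  have hv : N % B ≤ B := (Nat.mod_lt N hB).le
  have hN : N / B * B + N % B = N := Nat.div_add_mod' N B
  have h3 : |∑ a ∈ Finset.range (N % B), h (N / B * B + a) - (N % B : ℕ) * I| ≤ 2 * M * B := by
    calc _ ≤ |∑ a ∈ Finset.range (N % B), h (N / B * B + a)| + |((N % B : ℕ) : ℝ) * I| :=
          abs_sub _ _
      _ ≤ (N % B : ℕ) * M + (N % B : ℕ) * M := by
          gcongr
          · refine (Finset.abs_sum_le_sum_abs _ _).trans
              ((Finset.sum_le_sum fun a _ => hM _).trans_eq (by simp))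
          · rw [abs_mul, Nat.abs_cast]
            gcongr
      _ = 2 * M * (N % B : ℕ) := by ring
      _ ≤ 2 * M * B := by gcongr
  have h4 : ((N / B * B : ℕ) : ℝ) * η ≤ N * η := by
    gcongr
    exact Nat.div_mul_le_self N B
  have h5 : (N : ℝ) = (N / B * B : ℕ) + (N % B : ℕ) := by exact_mod_cast hN.symm
  have h6 : ∑ i ∈ Finset.range N, h i = ∑ i ∈ Finset.range (N / B * B), h i +
      ∑ a ∈ Finset.range (N % B), h (N / B * B + a) := by
    rw [← Finset.sum_range_add, hN]
  rw [h6]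
  have h7 : (N : ℝ) * I = (N / B * B : ℕ) * I + (N % B : ℕ) * I := by rw [h5]; ring
  rw [h7, add_sub_add_comm]
  exact (abs_add_le _ _).trans (by linarith)

/-- An integer fortieth root makes every parameter an integer power: the exponents `4/5`, `3/4` and
`9/20` of `Q` become `32`, `30` and `18`. -/
theorem exists_fortieth_root (Q : ℕ) : ∃ R : ℕ, R ^ 40 ≤ Q ∧ Q < (R + 1) ^ 40 := by
  classical
  have hex : ∃ k, Q < (k + 1) ^ 40 :=
    ⟨Q, lt_of_lt_of_le (Nat.lt_succ_self Q) (Nat.le_self_pow (by norm_num) _)⟩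
  refine ⟨Nat.find hex, ?_, Nat.find_spec hex⟩
  rcases Nat.eq_zero_or_pos (Nat.find hex) with h0 | h0
  · rw [h0]; simp
  · have := Nat.find_min hex (m := Nat.find hex - 1) (by omega)
    rw [Nat.sub_add_cancel h0] at this
    exact not_lt.mp this

variable {X : Type*} {T : X → X} {f : X → ℝ} {M I : ℝ} {q R : ℕ → ℕ}

/-- Averages along squares of length comparable to `q (n + 1)`. -/
theorem eventually_square_average_of_le (hM : ∀ x, |f x| ≤ M) (hI : |I| ≤ M)
    (hq : StrictMono q) (hcop : ∀ n, (q n).Coprime (q (n + 1)))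
    (hRl : ∀ n, R n ^ 40 ≤ q n) (hRu : ∀ n, q n < (R n + 1) ^ 40)
    (hR : Tendsto R atTop atTop) (hmono : Monotone R)
    (hrig : ∀ ε > 0, ∀ᶠ n in atTop, ∀ x, ∀ t < R (n + 1) ^ 32, |f (T^[t * q n] x) - f x| ≤ ε)
    (hbirk : ∀ ε > 0, ∀ᶠ N : ℕ in atTop, ∀ x,
      |∑ i ∈ Finset.range N, f (T^[i] x) - N * I| ≤ N * ε) {ε : ℝ} (hε : 0 < ε) :
    ∀ᶠ n in atTop, ∀ N, R (n + 1) ^ 31 ≤ N → N ≤ R (n + 1) ^ 41 → ∀ x,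
      |∑ i ∈ Finset.range N, f (T^[i ^ 2] x) - N * I| ≤ N * ε := by
  -- Of the six parts, three go to almost periodicity, one to the exponential sums, one to the
  -- Birkhoff average over `[0, Q)`, and one to the incomplete last block.
  have he : 0 < ε / 6 := by positivity
  set e := ε / 6 with hedef
  have hM0 : 0 ≤ M := (abs_nonneg _).trans hI
  have hR1 : Tendsto (fun n => R (n + 1)) atTop atTop := hR.comp (tendsto_add_atTop_nat 1)
  have hR1R : Tendsto (fun n => (R (n + 1) : ℝ)) atTop atTop :=
    tendsto_natCast_atTop_atTop.comp hR1
  have hq1 : Tendsto (fun n => q (n + 1)) atTop atTop :=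
    hq.tendsto_atTop.comp (tendsto_add_atTop_nat 1)
  have herr : ∀ᶠ n in atTop,
      M * √((4 * (84 + 81 * 2 ^ 40) + (2 ^ 40) ^ 2) / (R (n + 1) : ℝ)) ≤ e := by
    have h1 := ((hR1R.const_div_atTop (4 * (84 + 81 * 2 ^ 40) + (2 ^ 40) ^ 2 : ℝ)).sqrt).const_mul M
    rw [Real.sqrt_zero, mul_zero] at h1
    exact h1.eventually_le_const he
  filter_upwards [hrig e he, (tendsto_add_atTop_nat 1).eventually (hrig e he),
    hq1.eventually (hbirk e he), herr, hR1.eventually_ge_atTop 3,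
    hR1R.eventually_ge_atTop (2 * M / e)] with n hn1 hn2 hn3 hn4 hn5 hn6 N hN1 hN2 x
  set r := R (n + 1) with hr
  have hr0 : 0 < r := by omega
  have hQ0 : 0 < q (n + 1) := lt_of_le_of_lt (Nat.zero_le _) (hq (Nat.lt_succ_self n))
  have : NeZero (q (n + 1)) := ⟨hQ0.ne'⟩
  have hQR : (0 : ℝ) < q (n + 1) := Nat.cast_pos.mpr hQ0
  have hblocks := abs_sum_sub_le_of_blocks (h := fun i => f (T^[i ^ 2] x)) (M := M) (I := I)
    (η := 5 * e) (fun i => hM _) hI (by positivity) (B := r ^ 30) (N := N) (by positivity) ?_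
  · refine hblocks.trans ?_
    have h1 : 2 * M * (r ^ 30 : ℕ) ≤ N * e := by
      rw [div_le_iff₀ he] at hn6
      calc 2 * M * (r ^ 30 : ℕ) ≤ (r * e) * (r ^ 30 : ℕ) := by gcongr
        _ = (r ^ 31 : ℕ) * e := by push_cast; ring
        _ ≤ N * e := by gcongr
    have h2 : ε = 6 * e := by rw [hedef]; ring
    rw [h2]
    linarith
  · intro j hj
    set b := j * r ^ 30 with hb
    have hbN : b ≤ r ^ 41 := by
      have : j * r ^ 30 ≤ (j + 1) * r ^ 30 := Nat.mul_le_mul_right _ (Nat.le_succ j)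
      omega
    let y := T^[b ^ 2] x
    have hsq : ∀ a, f (T^[(b + a) ^ 2] x) = f (T^[a ^ 2 + 2 * b * a] y) := by
      intro a
      simp only [y]
      rw [← Function.iterate_add_apply]
      congr 2
      ring
    have hshift : ∀ s t k, f (T^[s + t * k] y) = f (T^[t * k] (T^[s] y)) := by
      intro s t k
      rw [add_comm, Function.iterate_add_apply]
    have hL : r ^ 32 ≤ R (n + 2) ^ 32 := Nat.pow_le_pow_left (hmono (Nat.le_succ _)) _
    -- This is what limits `N` to `r^41`: the cross term is of order `r^71`, while `Q L` is at least
    -- `r^72`; `r ≥ 3` absorbs the constant.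
    have hcond : (r ^ 30) ^ 2 + 2 * b * r ^ 30 ≤ q (n + 1) * r ^ 32 := by
      calc (r ^ 30) ^ 2 + 2 * b * r ^ 30 ≤ r ^ 71 + 2 * r ^ 41 * r ^ 30 := by
            refine Nat.add_le_add ?_ (Nat.mul_le_mul_right _ (Nat.mul_le_mul_left _ hbN))
            rw [← pow_mul]
            exact Nat.pow_le_pow_right hr0 (by norm_num)
        _ = 3 * r ^ 71 := by ring
        _ ≤ r * r ^ 71 := Nat.mul_le_mul_right _ hn5
        _ = r ^ 40 * r ^ 32 := by ring
        _ ≤ _ := Nat.mul_le_mul_right _ (hRl _)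
    have hmain := abs_sum_quadratic_sub_average_le (g := fun s => f (T^[s] y)) (M := M) (ε := e)
      (fun s => hM _) (hcop n) (hq (Nat.lt_succ_self n)) (L := r ^ 32) (by positivity)
      (fun s t ht => by rw [hshift]; exact hn1 _ t ht)
      (fun s t ht => by rw [hshift]; exact hn2 _ t (lt_of_lt_of_le ht hL)) hcond
      (K := r ^ 18) (by positivity)
    have herror := second_moment_error_le hr0 (hRl (n + 1)) (hRu (n + 1))
    have hbk := hn3 y
    have h1 : M * √(2 * (r ^ 18 : ℕ) * (2 * (2 * (r ^ 18 : ℕ) * (r ^ 30 : ℕ) ^ 2 / q (n + 1) +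
      (r ^ 30 : ℕ) * (2 + Real.log (q (n + 1))) + q (n + 1) * (1 + Real.log (q (n + 1))))) *
        (r ^ 32 : ℕ) ^ 2 + (r ^ 30 : ℕ) ^ 2 * q (n + 1) ^ 2 / (2 * (r ^ 18 : ℕ))) / (r ^ 32 : ℕ) ≤
        (r ^ 30 : ℕ) * e := by
      rw [mul_div_assoc]
      refine (mul_le_mul_of_nonneg_left herror hM0).trans ?_
      rw [mul_left_comm]
      exact mul_le_mul_of_nonneg_left hn4 (Nat.cast_nonneg _)
    have h2 : |((r ^ 30 : ℕ) : ℝ) / q (n + 1) * ∑ i ∈ Finset.range (q (n + 1)), f (T^[i] y) -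
        (r ^ 30 : ℕ) * I| ≤ (r ^ 30 : ℕ) * e := by
      have h3 : ((r ^ 30 : ℕ) : ℝ) / q (n + 1) * ∑ i ∈ Finset.range (q (n + 1)), f (T^[i] y) -
        (r ^ 30 : ℕ) * I = ((r ^ 30 : ℕ) : ℝ) / q (n + 1) *
          (∑ i ∈ Finset.range (q (n + 1)), f (T^[i] y) - q (n + 1) * I) := by
        field_simp
      rw [h3, abs_mul, abs_of_nonneg (by positivity)]
      refine (mul_le_mul_of_nonneg_left hbk (by positivity)).trans_eq ?_
      field_simp
    simp only [hsq]
    have h4 := abs_sub_le (∑ a ∈ Finset.range (r ^ 30), f (T^[a ^ 2 + 2 * b * a] y))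
      (((r ^ 30 : ℕ) : ℝ) / q (n + 1) * ∑ i ∈ Finset.range (q (n + 1)), f (T^[i] y))
      ((r ^ 30 : ℕ) * I)
    have h5 := hmain.trans (add_le_add_right h1 _)
    have h6 : ((r ^ 30 : ℕ) : ℝ) * (3 * e) + (r ^ 30 : ℕ) * e + (r ^ 30 : ℕ) * e =
      (r ^ 30 : ℕ) * (5 * e) := by ring
    linarith

/-- Averages along squares of length between `q (n + 1)` and `q (n + 2)`. -/
theorem eventually_square_average_of_ge (hM : ∀ x, |f x| ≤ M) (hI : |I| ≤ M)
    (hq : StrictMono q) (hcop : ∀ n, (q n).Coprime (q (n + 1)))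
    (hRl : ∀ n, R n ^ 40 ≤ q n) (hRu : ∀ n, q n < (R n + 1) ^ 40)
    (hR : Tendsto R atTop atTop) (hmono : Monotone R)
    (hrig : ∀ ε > 0, ∀ᶠ n in atTop, ∀ x, ∀ t < R (n + 1) ^ 32, |f (T^[t * q n] x) - f x| ≤ ε)
    (hbirk : ∀ ε > 0, ∀ᶠ N : ℕ in atTop, ∀ x,
      |∑ i ∈ Finset.range N, f (T^[i] x) - N * I| ≤ N * ε) {ε : ℝ} (hε : 0 < ε) :
    ∀ᶠ n in atTop, ∀ N, R (n + 1) ^ 41 ≤ N → N ≤ R (n + 2) ^ 31 → ∀ x,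
      |∑ i ∈ Finset.range N, f (T^[i ^ 2] x) - N * I| ≤ N * ε := by
  -- One part each for rigidity at `Q`, the average of length `Q`, and the incomplete last block.
  have he : 0 < ε / 3 := by positivity
  set e := ε / 3 with hedef
  have hM0 : 0 ≤ M := (abs_nonneg _).trans hI
  have hR1 : Tendsto (fun n => R (n + 1)) atTop atTop := hR.comp (tendsto_add_atTop_nat 1)
  have hR1R : Tendsto (fun n => (R (n + 1) : ℝ)) atTop atTop :=
    tendsto_natCast_atTop_atTop.comp hR1
  filter_upwards [(tendsto_add_atTop_nat 1).eventually (hrig e he),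
    eventually_square_average_of_le hM hI hq hcop hRl hRu hR hmono hrig hbirk he,
    hR1.eventually_ge_atTop 3, hR1R.eventually_ge_atTop (2 ^ 40),
    hR1R.eventually_ge_atTop (2 * M * 2 ^ 40 / e)] with n hn1 hn2 hn3 hn4 hn5 N hN1 hN2 x
  set r := R (n + 1) with hr
  have hr0 : 0 < r := by omega
  have hrR : (1 : ℝ) ≤ r := by exact_mod_cast hr0
  set Q := q (n + 1) with hQdef
  have hQ0 : 0 < Q := lt_of_le_of_lt (Nat.zero_le _) (hq (Nat.lt_succ_self n))
  have hQu : (Q : ℝ) ≤ 2 ^ 40 * (r : ℝ) ^ 40 := by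
    have h1 : (Q : ℝ) ≤ ((r : ℝ) + 1) ^ 40 := by exact_mod_cast (hRu (n + 1)).le
    calc (Q : ℝ) ≤ ((r : ℝ) + 1) ^ 40 := h1
      _ ≤ (2 * (r : ℝ)) ^ 40 := by gcongr; linarith
      _ = _ := by rw [mul_pow]
  have hQ1 : r ^ 31 ≤ Q := (Nat.pow_le_pow_right hr0 (by norm_num)).trans (hRl (n + 1))
  have hQ2 : Q ≤ r ^ 41 := by
    have : (Q : ℝ) ≤ (r : ℝ) ^ 41 := by
      calc (Q : ℝ) ≤ 2 ^ 40 * (r : ℝ) ^ 40 := hQu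
        _ ≤ (r : ℝ) * (r : ℝ) ^ 40 := by gcongr
        _ = _ := by ring
    exact_mod_cast this
  have hr2 : 3 ≤ R (n + 2) := hn3.trans (hmono (Nat.le_succ _))
  have hblocks := abs_sum_sub_le_of_blocks (h := fun i => f (T^[i ^ 2] x)) (M := M) (I := I)
    (η := 2 * e) (fun i => hM _) hI (by positivity) (B := Q) (N := N) hQ0 ?_
  · refine hblocks.trans ?_
    have h1 : 2 * M * (Q : ℝ) ≤ N * e := by
      rw [div_le_iff₀ he] at hn5
      calc 2 * M * (Q : ℝ) ≤ 2 * M * (2 ^ 40 * (r : ℝ) ^ 40) := by gcongr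
        _ = (2 * M * 2 ^ 40) * (r : ℝ) ^ 40 := by ring
        _ ≤ (r * e) * (r : ℝ) ^ 40 := by gcongr
        _ = (r ^ 41 : ℕ) * e := by push_cast; ring
        _ ≤ N * e := by gcongr
    have h2 : ε = 3 * e := by rw [hedef]; ring
    rw [h2]
    linarith
  · intro j hj
    let y := T^[(j * Q) ^ 2] x
    have hjN : j * Q ≤ N := le_trans (Nat.mul_le_mul_right _ (Nat.le_succ j)) hj
    have hterm : ∀ a ∈ Finset.range Q,
        |f (T^[(j * Q + a) ^ 2] x) - f (T^[a ^ 2] y)| ≤ e := by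
      intro a ha
      have ha' : a < Q := Finset.mem_range.mp ha
      -- The cross term is the multiple `2ja` of `Q`. Since `jQ ≤ N`, this multiple is at most twice
      -- the 31st power of the next root, hence within its rigidity range.
      have hsq : f (T^[(j * Q + a) ^ 2] x) = f (T^[(2 * j * a) * Q] (T^[a ^ 2] y)) := by
        simp only [y]
        rw [← Function.iterate_add_apply, ← Function.iterate_add_apply]
        congr 2
        ring
      rw [hsq]
      refine hn1 _ _ ?_
      have h1 : j * a ≤ j * Q := Nat.mul_le_mul_left _ ha'.le
      have h2 : 3 * R (n + 2) ^ 31 ≤ R (n + 2) ^ 32 := by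
        rw [pow_succ' _ 31]
        exact Nat.mul_le_mul_right _ hr2
      have h3 : 0 < R (n + 2) ^ 31 := by positivity
      rw [mul_assoc]
      show 2 * (j * a) < R (n + 2) ^ 32
      omega
    have hA : |∑ a ∈ Finset.range Q, f (T^[(j * Q + a) ^ 2] x) -
        ∑ a ∈ Finset.range Q, f (T^[a ^ 2] y)| ≤ Q * e := by
      rw [← Finset.sum_sub_distrib]
      refine (Finset.abs_sum_le_sum_abs _ _).trans ((Finset.sum_le_sum hterm).trans_eq ?_)
      simp
    have hC := hn2 Q hQ1 hQ2 y
    have h4 := abs_sub_le (∑ a ∈ Finset.range Q, f (T^[(j * Q + a) ^ 2] x))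
      (∑ a ∈ Finset.range Q, f (T^[a ^ 2] y)) (Q * I)
    linarith

/-- Equidistribution along squares for a rigid system with uniform Birkhoff averages. -/
theorem eventually_square_average (hM : ∀ x, |f x| ≤ M) (hI : |I| ≤ M)
    (hq : StrictMono q) (hcop : ∀ n, (q n).Coprime (q (n + 1)))
    (hRl : ∀ n, R n ^ 40 ≤ q n) (hRu : ∀ n, q n < (R n + 1) ^ 40)
    (hrig : ∀ ε > 0, ∀ᶠ n in atTop, ∀ x, ∀ t < R (n + 1) ^ 32, |f (T^[t * q n] x) - f x| ≤ ε)
    (hbirk : ∀ ε > 0, ∀ᶠ N : ℕ in atTop, ∀ x,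
      |∑ i ∈ Finset.range N, f (T^[i] x) - N * I| ≤ N * ε) {ε : ℝ} (hε : 0 < ε) :
    ∀ᶠ N : ℕ in atTop, ∀ x, |∑ i ∈ Finset.range N, f (T^[i ^ 2] x) - N * I| ≤ N * ε := by
  have hmono : Monotone R := by
    refine monotone_nat_of_le_succ fun n => Nat.lt_succ_iff.mp ?_
    refine lt_of_pow_lt_pow_left₀ 40 (Nat.zero_le _) ?_
    exact (hRl n).trans_lt ((hq (Nat.lt_succ_self n)).trans (hRu (n + 1)))
  have hR : Tendsto R atTop atTop := by
    refine tendsto_atTop.mpr fun A => ?_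
    filter_upwards [hq.tendsto_atTop.eventually_ge_atTop (A ^ 40)] with n hn
    exact Nat.lt_succ_iff.mp (lt_of_pow_lt_pow_left₀ 40 (Nat.zero_le _) (hn.trans_lt (hRu n)))
  obtain ⟨n₀, hn₀⟩ := eventually_atTop.mp
    ((eventually_square_average_of_le hM hI hq hcop hRl hRu hR hmono hrig hbirk hε).and
      (eventually_square_average_of_ge hM hI hq hcop hRl hRu hR hmono hrig hbirk hε))
  filter_upwards [eventually_ge_atTop (R (n₀ + 1) ^ 41)] with N hN x
  -- The least such index places `N` between consecutive 41st powers; the 31st power of the larger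
  -- root decides which of the two regimes applies.
  have hex : ∃ n, N < R n ^ 41 := by
    obtain ⟨n, hn⟩ := (hR.eventually_gt_atTop N).exists
    exact ⟨n, lt_of_lt_of_le hn (Nat.le_self_pow (by norm_num) _)⟩
  classical
  have hlt := Nat.find_spec hex
  have hgt : n₀ + 1 < Nat.find hex := by
    by_contra h
    push Not at h
    have := Nat.pow_le_pow_left (hmono h) 41
    omega
  obtain ⟨m, hm⟩ : ∃ m, Nat.find hex = m + 2 := ⟨Nat.find hex - 2, by omega⟩
  have hmin : R (m + 1) ^ 41 ≤ N := not_lt.mp (Nat.find_min hex (m := m + 1) (by omega))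
  rw [hm] at hlt
  rcases le_total N (R (m + 2) ^ 31) with h | h
  · exact (hn₀ m (by omega)).2 N hmin h x
  · exact (hn₀ (m + 1) (by omega)).1 N h hlt.le x

end SquareAverages

/-! ### Passage to the topological statement -/

/-- Real suprema dominate their terms only for bounded families; here the diameter of the compact
space bounds both of them. -/
theorem dist_le_rigidityDefect {X : Type*} [MetricSpace X] [CompactSpace X] (T : X ≃ₜ X) (q : ℕ)
    (b : ℝ) (x : X) {t : ℕ} (ht : (t : ℝ) < b) :
    dist x ((⇑T)^[t * q] x) ≤ rigidityDefect T q b := by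
  have : Nonempty X := ⟨x⟩
  have hd : ∀ y z : X, dist y z ≤ Metric.diam (Set.univ : Set X) := fun y z =>
    Metric.dist_le_diam_of_mem isCompact_univ.isBounded (Set.mem_univ y) (Set.mem_univ z)
  have h1 : dist x ((⇑T)^[t * q] x) ≤ ⨆ x : X, dist x ((⇑T)^[t * q] x) :=
    le_ciSup (f := fun x : X => dist x ((⇑T)^[t * q] x))
      ⟨_, by rintro _ ⟨y, rfl⟩; exact hd _ _⟩ x
  refine h1.trans ?_
  exact le_ciSup (f := fun t : {t : ℕ // (t : ℝ) < b} => ⨆ x : X, dist x ((⇑T)^[t * q] x))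
    ⟨Metric.diam (Set.univ : Set X), by
      rintro _ ⟨s, rfl⟩; exact ciSup_le fun y => hd _ _⟩ ⟨t, ht⟩

/-- The real-valued case of the theorem. -/
theorem eventually_square_average_real {X : Type*} [MetricSpace X] [CompactSpace X]
    [MeasurableSpace X] [BorelSpace X] (T : X ≃ₜ X) (hT : IsUniquelyErgodic T)
    (μ : Measure X) [IsProbabilityMeasure μ] (hμ : MeasurePreserving T μ μ)
    (q : ℕ → ℕ) (hq_mono : StrictMono q) (hq_gcd : ∀ n, Nat.gcd (q n) (q (n + 1)) = 1)
    (hrigid : Tendsto (fun n => rigidityDefect T (q n) ((q (n + 1) : ℝ) ^ (4 / 5 : ℝ)))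
      atTop (𝓝 0))
    (f : C(X, ℝ)) {ε : ℝ} (hε : 0 < ε) :
    ∀ᶠ N : ℕ in atTop, ∀ x,
      |∑ i ∈ Finset.range N, f ((⇑T)^[i ^ 2] x) - N * ∫ y, f y ∂μ| ≤ N * ε := by
  choose R hRl hRu using fun n => exists_fortieth_root (q n)
  refine eventually_square_average (T := T) (f := f) (M := ‖f‖) (fun x => f.norm_coe_le_norm x) ?_
    hq_mono hq_gcd hRl hRu ?_ ?_ hε
  · have := norm_integral_le_of_norm_le_const (μ := μ) (f := f) (C := ‖f‖)
      (Eventually.of_forall fun x => f.norm_coe_le_norm x)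
    simpa using this
  · intro e he
    obtain ⟨δ, hδ, hf⟩ := Metric.uniformContinuous_iff.mp
      (CompactSpace.uniformContinuous_of_continuous f.continuous) e he
    filter_upwards [hrigid.eventually_lt_const hδ] with n hn x t ht
    have ht' : (t : ℝ) < (q (n + 1) : ℝ) ^ (4 / 5 : ℝ) := by
      have h1 : (R (n + 1) : ℝ) ^ 40 ≤ q (n + 1) := by exact_mod_cast hRl (n + 1)
      -- The exponent `4/5` of the rigidity hypothesis is exactly what allows `L = R^32`.
      have h2 : ((R (n + 1) : ℝ) ^ 40) ^ (4 / 5 : ℝ) = (R (n + 1) : ℝ) ^ 32 := by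
        rw [← Real.rpow_natCast, ← Real.rpow_natCast, ← Real.rpow_mul (Nat.cast_nonneg _)]
        norm_num
      calc (t : ℝ) < (R (n + 1) : ℝ) ^ 32 := by exact_mod_cast ht
        _ = ((R (n + 1) : ℝ) ^ 40) ^ (4 / 5 : ℝ) := h2.symm
        _ ≤ _ := Real.rpow_le_rpow (by positivity) h1 (by norm_num)
    have h3 := hf ((dist_le_rigidityDefect T (q n) _ x ht').trans_lt hn)
    rw [dist_comm, Real.dist_eq] at h3
    exact h3.le
  · intro e he
    -- The Birkhoff statement at index `N` averages `N + 1` terms, hence the shift by one.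
    have h1 := (tendsto_sub_atTop_nat 1).eventually (hT.eventually_birkhoff hμ f he)
    filter_upwards [h1, eventually_ge_atTop 1] with N hN hN1 x
    have h2 := hN x
    obtain ⟨m, rfl⟩ : ∃ m, N = m + 1 := ⟨N - 1, by omega⟩
    rw [Nat.add_sub_cancel] at h2
    push_cast
    have hm : (0 : ℝ) < (m : ℝ) + 1 := by positivity
    have h3 : ∑ i ∈ Finset.range (m + 1), f ((⇑T)^[i] x) - ((m : ℝ) + 1) * ∫ y, f y ∂μ =
        ((m : ℝ) + 1) * (((m : ℝ) + 1)⁻¹ * ∑ i ∈ Finset.range (m + 1), f ((⇑T)^[i] x) -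
          ∫ y, f y ∂μ) := by
      field_simp
    rw [h3, abs_mul, abs_of_pos hm]
    gcongr

theorem theorem1p1 {X : Type*} [MetricSpace X] [CompactSpace X] [MeasurableSpace X] [BorelSpace X]
    {𝕜 : Type*} [RCLike 𝕜] (T : X ≃ₜ X) (hT : IsUniquelyErgodic T)
    (μ : Measure X) [IsProbabilityMeasure μ] (hμ : MeasurePreserving T μ μ)
    (q : ℕ → ℕ) (hq_pos : ∀ n, 0 < q n) (hq_mono : StrictMono q)
    (hq_gcd : ∀ n, Nat.gcd (q n) (q (n + 1)) = 1)
    (hrigid : Tendsto (fun n => rigidityDefect T (q n) ((q (n + 1) : ℝ) ^ (4 / 5 : ℝ)))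
      atTop (𝓝 0))
    (f : C(X, 𝕜)) :
    TendstoUniformly
      (fun (N : ℕ) (x : X) => (N : 𝕜)⁻¹ * ∑ i ∈ Finset.range N, f ((⇑T)^[i ^ 2] x))
      (fun _ => ∫ y, f y ∂μ) atTop := by
  rw [Metric.tendstoUniformly_iff]
  intro ε hε
  -- Real and imaginary parts use two thirds of `ε`; the remaining third makes the final inequality
  -- strict.
  have he : 0 < ε / 3 := by positivity
  have hint : Integrable f μ :=
    f.continuous.integrable_of_hasCompactSupport (HasCompactSupport.of_compactSpace _)
  let fre : C(X, ℝ) := ⟨fun x => RCLike.re (f x), RCLike.continuous_re.comp f.continuous⟩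
  let fim : C(X, ℝ) := ⟨fun x => RCLike.im (f x), RCLike.continuous_im.comp f.continuous⟩
  filter_upwards [eventually_square_average_real T hT μ hμ q hq_mono hq_gcd hrigid fre he,
    eventually_square_average_real T hT μ hμ q hq_mono hq_gcd hrigid fim he,
    eventually_ge_atTop 1] with N hre him hN x
  have hN0 : (0 : ℝ) < N := by exact_mod_cast hN
  have hNk : (N : 𝕜) ≠ 0 := by exact_mod_cast hN0.ne'
  have h1 : (N : 𝕜)⁻¹ * ∑ i ∈ Finset.range N, f ((⇑T)^[i ^ 2] x) - ∫ y, f y ∂μ =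
      (N : 𝕜)⁻¹ * (∑ i ∈ Finset.range N, f ((⇑T)^[i ^ 2] x) - N * ∫ y, f y ∂μ) := by
    field_simp
  rw [dist_comm, dist_eq_norm, h1, norm_mul, norm_inv, RCLike.norm_natCast,
    inv_mul_lt_iff₀ hN0]
  set z : 𝕜 := ∑ i ∈ Finset.range N, f ((⇑T)^[i ^ 2] x) - N * ∫ y, f y ∂μ with hz
  have hzre : RCLike.re z = ∑ i ∈ Finset.range N, fre ((⇑T)^[i ^ 2] x) - N * ∫ y, fre y ∂μ := by
    rw [hz, map_sub, map_sum, ← RCLike.ofReal_natCast, RCLike.re_ofReal_mul]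
    congr 2
    exact (integral_re hint).symm
  have hzim : RCLike.im z = ∑ i ∈ Finset.range N, fim ((⇑T)^[i ^ 2] x) - N * ∫ y, fim y ∂μ := by
    rw [hz, map_sub, map_sum, ← RCLike.ofReal_natCast, RCLike.im_ofReal_mul]
    congr 2
    exact (integral_im hint).symm
  have h2 : ‖z‖ ≤ |RCLike.re z| + |RCLike.im z| := by
    refine (sq_le_sq₀ (norm_nonneg _) (by positivity)).mp ?_
    rw [RCLike.norm_sq_eq_def, add_sq, sq_abs, sq_abs]
    nlinarith [mul_nonneg (abs_nonneg (RCLike.re z)) (abs_nonneg (RCLike.im z))]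
  have h3 := hre x
  have h4 := him x
  rw [← hzre] at h3
  rw [← hzim] at h4
  have h5 : (N : ℝ) * ε = 3 * (N * (ε / 3)) := by ring
  have h6 : 0 < (N : ℝ) * (ε / 3) := by positivity
  linarith
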